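/- An \emph{algebra} here is a first-order structure $\mathcal A=(A,0,1,+,-,1',\breve{\ },;)$ of the similarity type of relation algebras. Write $x\cdot y=-(-x+-y)$, and $x\le y$ for $x+y=y$. $\mathcal A$ is a \emph{non-associative algebra} if $(A,0,1,+,-)$ is a boolean algebra and, for all $x,y,z\in A$: $1';x=x=x;1'$; $\breve{\breve x}=x$; $(x;y)\breve{\ }=\breve y;\breve x$; $\breve 0=x;0=0$; $(x+y)\breve{\ }=\breve x+\breve y$; $x;(y+z)=(x;y)+(x;z)$; and $(x;y)\cdot\breve z=0$ if and only if $(y;z)\cdot\breve x=0$. It is a \emph{relation algebra} if moreover $;$ is associative. Let $\mathcal A$ be a non-associative algebra, let $D$ be a set, and let $\phi:A\to\wp(D\times D)$ be an injective map, written $a\mapsto a^\phi$, with $0^\phi=\varnothing$, $1^\phi=D\times D$, $(1')^\phi=\{(x,x):x\in D\}$, $(a+b)^\phi=a^\phi\cup b^\phi$, $(-a)^\phi=(D\times D)\setminus a^\phi$ and $(\breve a)^\phi=\{(y,x):(x,y)\in a^\phi\}$ for all $a,b\in A$. Let $\circ$ denote composition of binary relations. Then $\phi$ is a \emph{feeble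 representation} if $(a;b)^\phi\supseteq a^\phi\circ b^\phi$ for all $a,b\in A$; a \emph{qualitative representation} if, for all $a,b,c\in A$, $c^\phi\supseteq a^\phi\circ b^\phi$ if and only if $c\ge a;b$; and a \emph{strong representation} if it is a qualitative representation and $(a;b)^\phi=a^\phi\circ b^\phi$ for all $a,b\in A$. An algebra is \emph{feebly} (\emph{strongly}) \emph{representable} if it has a feeble (strong) representation. \textbf{Theorem.} Let $\mathcal K$ be any class of algebras which contains all strongly representable relation algebras and is contained in the class of all feebly representable non-associative algebras. Then $\mathcal K$ has no finite axiomatisation in first-order logic, i.e. there is no finite set $T$ of first-order sentences in the language $(0,1,+,-,1',\breve{\ },;)$ such that, for every algebra $\mathcal A$, $\mathcal A\in\mathcal K$ if and only if $\mathcal A\models T$. -/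

import Mathlib

open FirstOrder

universe u v

/-- The function symbols of the similarity type of relation algebras
`(0, 1, +, -, 1', ˘, ;)`, indexed by their arities. -/
inductive RelAlgFunc : ℕ → Type
  | zero : RelAlgFunc 0
  | one : RelAlgFunc 0
  | ident : RelAlgFunc 0
  | neg : RelAlgFunc 1
  | conv : RelAlgFunc 1
  | add : RelAlgFunc 2
  | comp : RelAlgFunc 2

/-- The first-order language of relation algebras: the seven operation symbols above,
and no relation symbol apart from equality. -/
def relAlgLang : FirstOrder.Language.{0, 0} where
  Functions := RelAlgFunc
  Relations := fun _ => Empty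

namespace RelAlg

section Operations

variable {A : Type u} [relAlgLang.Structure A]

/-- The constant `0`. -/
def zero : A := FirstOrder.Language.Structure.funMap (L := relAlgLang) RelAlgFunc.zero ![]

/-- The constant `1`. -/
def one : A := FirstOrder.Language.Structure.funMap (L := relAlgLang) RelAlgFunc.one ![]

/-- The identity constant `1'`. -/
def ident : A := FirstOrder.Language.Structure.funMap (L := relAlgLang) RelAlgFunc.ident ![]

/-- Boolean complement `-x`. -/
def neg (x : A) : A := FirstOrder.Language.Structure.funMap (L := relAlgLang) RelAlgFunc.neg ![x]

/-- Converse `x˘`. -/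
def conv (x : A) : A := FirstOrder.Language.Structure.funMap (L := relAlgLang) RelAlgFunc.conv ![x]

/-- Boolean sum `x + y`. -/
def add (x y : A) : A :=
  FirstOrder.Language.Structure.funMap (L := relAlgLang) RelAlgFunc.add ![x, y]

/-- (Abstract) composition `x ; y`. -/
def comp (x y : A) : A :=
  FirstOrder.Language.Structure.funMap (L := relAlgLang) RelAlgFunc.comp ![x, y]

/-- The meet `x · y`, an abbreviation for `-(-x + -y)`. -/
def meet (x y : A) : A := neg (add (neg x) (neg y))

/-- The order `x ≤ y`, an abbreviation for `x + y = y`. -/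
def le (x y : A) : Prop := add x y = y

end Operations

/-- Non-associative algebras (the variety `NA`). -/
structure IsNonAssociativeAlgebra (A : Type u) [relAlgLang.Structure A] : Prop where
  /-- `(A, 0, 1, +, -)` is a boolean algebra. -/
  boolean : ∃ B : BooleanAlgebra A,
    (∀ x y : A, B.sup x y = add x y) ∧ (∀ x : A, B.compl x = neg x) ∧
      B.bot = zero ∧ B.top = one
  ident_comp : ∀ x : A, comp ident x = x
  comp_ident : ∀ x : A, comp x ident = x
  conv_conv : ∀ x : A, conv (conv x) = x
  conv_comp : ∀ x y : A, conv (comp x y) = comp (conv y) (conv x)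
  conv_zero : conv (zero : A) = zero
  comp_zero : ∀ x : A, comp x zero = zero
  conv_add : ∀ x y : A, conv (add x y) = add (conv x) (conv y)
  comp_add : ∀ x y z : A, comp x (add y z) = add (comp x y) (comp x z)
  /-- The Peircean law. -/
  peirce : ∀ x y z : A, meet (comp x y) (conv z) = zero ↔ meet (comp y z) (conv x) = zero

/-- Relation algebras: non-associative algebras in which `;` is associative. -/
structure IsRelationAlgebra (A : Type u) [relAlgLang.Structure A] : Prop
    extends IsNonAssociativeAlgebra A where
  comp_assoc : ∀ x y z : A, comp (comp x y) z = comp x (comp y z)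

section Representations

variable {A : Type u} [relAlgLang.Structure A] {D : Type v}

/-- `φ` is an injection of `A` into the binary relations on the base `D` which respects the
boolean operators (with `1` interpreted as `D × D`), the identity and the converse. Its image is
then closed under the boolean operations and converse, and contains the identity relation. -/
structure IsRepresentationBase (φ : A → SetRel D D) : Prop where
  injective : Function.Injective φ
  map_zero : φ zero = ∅
  map_one : φ one = Set.univ
  map_ident : φ ident = SetRel.id
  map_add : ∀ a b : A, φ (add a b) = φ a ∪ φ b
  map_neg : ∀ a : A, φ (neg a) = Set.univ \ φ a
  map_conv : ∀ a : A, φ (conv a) = (φ a).inv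

/-- Feeble representations: `(a ; b)^φ ⊇ a^φ ∘ b^φ`. -/
structure IsFeebleRepresentation (φ : A → SetRel D D) : Prop
    extends IsRepresentationBase φ where
  comp_subset : ∀ a b : A, (φ a).comp (φ b) ⊆ φ (comp a b)

/-- Qualitative representations: `c^φ ⊇ a^φ ∘ b^φ` if and only if `c ≥ a ; b`. -/
structure IsQualitativeRepresentation (φ : A → SetRel D D) : Prop
    extends IsRepresentationBase φ where
  comp_subset_iff : ∀ a b c : A, (φ a).comp (φ b) ⊆ φ c ↔ le (comp a b) c

/-- Strong representations: qualitative representations with `(a ; b)^φ = a^φ ∘ b^φ`. -/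
structure IsStrongRepresentation (φ : A → SetRel D D) : Prop
    extends IsQualitativeRepresentation φ where
  map_comp : ∀ a b : A, φ (comp a b) = (φ a).comp (φ b)

end Representations

/-- `A` is a feebly representable non-associative algebra. -/
def IsFeeblyRepresentableNA (A : Type u) [relAlgLang.Structure A] : Prop :=
  IsNonAssociativeAlgebra A ∧
    ∃ (D : Type u) (φ : A → SetRel D D), IsFeebleRepresentation φ

/-- `A` is a strongly representable relation algebra. -/
def IsStronglyRepresentableRA (A : Type u) [relAlgLang.Structure A] : Prop :=
  IsRelationAlgebra A ∧
    ∃ (D : Type u) (φ : A → SetRel D D), IsStrongRepresentation φ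

/-- A class of algebras (of the type of relation algebras). -/
abbrev AlgebraClass : Type (u + 1) := Set (CategoryTheory.Bundled.{u} relAlgLang.Structure)

/-- `K` is axiomatised by finitely many first-order sentences: it is exactly the class of
models of a finite set of sentences. -/
def FinitelyAxiomatisable (K : AlgebraClass.{u}) : Prop :=
  ∃ T : relAlgLang.Theory, T.Finite ∧
    ∀ A : CategoryTheory.Bundled.{u} relAlgLang.Structure, A ∈ K ↔ A ⊨ T

end RelAlg

/-!
The algebras that separate the two kinds of representability are complex algebras in the style of
Monk. Fix a set `I` of types and a set `K` of colours. The atoms are the identity atoms, one for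
each type, and the edges `(i, c, j)` of each colour `c` between each two types `i`, `j`, equal or
not; a triangle of edges is consistent when its types match and it is not monochromatic.

If `I` is infinite and `K` is finite, there is no feeble representation. Its base would be
infinite, as the identity atoms are disjoint and none is empty, and feebleness turns the colours
into an edge colouring of the base by finitely many colours without monochromatic triangle. This
contradicts Ramsey's theorem (`not_forall_exists_colour_of_infinite`,
`not_isFeeblyRepresentableNA`).

If `K` is infinite and has at least as many elements as `I`, the obstacle disappears: there is a
saturated coloured complete graph without monochromatic triangles (`exists_isSaturatedColouring`).
It is generated freely: its vertices are formal terms, each asking for prescribed colours towards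
at most two earlier vertices, and all other edges get distinct colours that neither endpoint
mentions.

Take `I = ℕ` and `2 ^ k` colours for the `k`-th algebra. In a nonprincipal ultraproduct the types
and the colours become infinite sets, the colours number at least as many as the types
(`mk_product_nat_le`), and a saturated colouring strongly represents the ultraproduct of the
algebras (`IsSaturatedColouring.isStronglyRepresentableRA`). It is a relation algebra because it
embeds into an algebra of binary relations. So the ultraproduct is in the class while none of its
factors is, and Łoś's theorem rules out a finite axiomatisation.
-/

namespace RelAlg

/-! ### Algebras of binary relations -/

section Representations

variable {A : Type u} [relAlgLang.Structure A] {D : Type v} {φ : A → SetRel D D}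

theorem IsRepresentationBase.map_meet (h : IsRepresentationBase φ) (a b : A) :
    φ (meet a b) = φ a ∩ φ b := by
  simp only [meet, h.map_neg, h.map_add]
  ext p
  simp only [Set.mem_sdiff, Set.mem_univ, Set.mem_union, Set.mem_inter_iff]
  tauto

/-- The boolean operations of `A` are those of the field of sets `φ '' A`. -/
theorem IsRepresentationBase.boolean (h : IsRepresentationBase φ) :
    ∃ B : BooleanAlgebra A,
      (∀ x y : A, B.sup x y = add x y) ∧ (∀ x : A, B.compl x = neg x) ∧
        B.bot = zero ∧ B.top = one := by
  let _ : Max A := ⟨add⟩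
  let _ : Min A := ⟨meet⟩
  let _ : LE A := ⟨fun x y => φ x ≤ φ y⟩
  let _ : LT A := ⟨fun x y => φ x < φ y⟩
  let _ : Top A := ⟨one⟩
  let _ : Bot A := ⟨zero⟩
  let _ : Compl A := ⟨neg⟩
  let _ : SDiff A := ⟨fun x y => meet x (neg y)⟩
  let _ : HImp A := ⟨fun x y => add y (neg x)⟩
  have hneg : ∀ a : A, φ (neg a) = (φ a)ᶜ := fun a => by
    rw [h.map_neg, Set.compl_eq_univ_sdiff]
  refine ⟨h.injective.booleanAlgebra φ Iff.rfl Iff.rfl h.map_add h.map_meet h.map_one h.map_zero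
    hneg (fun a b => ?_) (fun a b => ?_), fun _ _ => rfl, fun _ => rfl, rfl, rfl⟩
  · exact (h.map_meet a (neg b)).trans (by rw [hneg]; rfl)
  · exact (h.map_add b (neg a)).trans (by rw [hneg, himp_eq]; rfl)

/-- An algebra that embeds into the algebra of all binary relations on a set is a relation
algebra, since the axioms hold for binary relations. -/
theorem IsRepresentationBase.isRelationAlgebra (h : IsRepresentationBase φ)
    (hcomp : ∀ a b : A, φ (comp a b) = (φ a).comp (φ b)) : IsRelationAlgebra A where
  boolean := h.boolean
  ident_comp x := h.injective (by rw [hcomp, h.map_ident, SetRel.id_comp])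
  comp_ident x := h.injective (by rw [hcomp, h.map_ident, SetRel.comp_id])
  conv_conv x := h.injective (by rw [h.map_conv, h.map_conv, SetRel.inv_inv])
  conv_comp x y := h.injective (by simp only [h.map_conv, hcomp, SetRel.inv_comp])
  conv_zero := h.injective (by rw [h.map_conv, h.map_zero]; rfl)
  comp_zero x := h.injective (by rw [hcomp, h.map_zero, SetRel.comp_empty])
  conv_add x y := h.injective (by simp only [h.map_conv, h.map_add]; rfl)
  comp_add x y z := h.injective (by
    simp only [hcomp, h.map_add]
    ext ⟨p, q⟩
    simp only [SetRel.mem_comp, Set.mem_union, and_or_left, exists_or])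
  peirce x y z := by
    rw [← h.injective.eq_iff, ← h.injective.eq_iff (a := meet (comp y z) _)]
    simp only [h.map_meet, hcomp, h.map_conv, h.map_zero, Set.eq_empty_iff_forall_notMem,
      Set.mem_inter_iff, Prod.forall, SetRel.mem_comp, SetRel.mem_inv]
    constructor
    · rintro H p q ⟨⟨r, h1, h2⟩, h3⟩
      exact H q r ⟨⟨p, h3, h1⟩, h2⟩
    · rintro H p q ⟨⟨r, h1, h2⟩, h3⟩
      exact H r p ⟨⟨q, h2, h3⟩, h1⟩
  comp_assoc x y z := h.injective (by simp only [hcomp, SetRel.comp_assoc])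

theorem IsRepresentationBase.isStrongRepresentation (h : IsRepresentationBase φ)
    (hcomp : ∀ a b : A, φ (comp a b) = (φ a).comp (φ b)) : IsStrongRepresentation φ where
  toIsRepresentationBase := h
  comp_subset_iff a b c := by
    rw [← hcomp, le, ← h.injective.eq_iff, h.map_add, Set.union_eq_right]
  map_comp := hcomp

end Representations

/-! ### Complex algebras of coloured atoms -/

/-- The atoms: edges with typed endpoints, labelled by a colour or, for the identity atoms, by
`none`. -/
@[ext]
structure ColourAtom (I K : Type*) where
  /-- The type of the initial point. -/
  src : I
  /-- The colour, `none` on the diagonal. -/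
  lab : Option K
  /-- The type of the final point. -/
  tgt : I
  eq_of_lab : lab = none → src = tgt

namespace ColourAtom

variable {I K : Type*}

/-- The converse atom. -/
def conv (a : ColourAtom I K) : ColourAtom I K :=
  ⟨a.tgt, a.lab, a.src, fun h => (a.eq_of_lab h).symm⟩

/-- The identity atom of a type. -/
def ident (i : I) : ColourAtom I K := ⟨i, none, i, fun _ => rfl⟩

/-- The atom `c` is below `a ; b`: the types match, identity labels act as an identity, and the
triangle is not monochromatic. -/
structure Triangle (a b c : ColourAtom I K) : Prop where
  src_eq : a.src = c.src
  mid_eq : a.tgt = b.src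
  tgt_eq : b.tgt = c.tgt
  left_ident : a.lab = none → b.lab = c.lab
  right_ident : b.lab = none → a.lab = c.lab
  ident_eq : c.lab = none → a.lab = b.lab
  not_mono : ∀ k : K, ¬ (a.lab = some k ∧ b.lab = some k ∧ c.lab = some k)

end ColourAtom

/-- The complex algebra of the atoms. -/
instance colourAlgebra (I K : Type*) : relAlgLang.Structure (Set (ColourAtom I K)) where
  funMap := fun {_} f => match f with
    | .zero => fun _ => ∅
    | .one => fun _ => Set.univ
    | .ident => fun _ => {a | a.lab = none}
    | .neg => fun v => (v 0)ᶜ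
    | .conv => fun v => {a | a.conv ∈ v 0}
    | .add => fun v => v 0 ∪ v 1
    | .comp => fun v => {c | ∃ a ∈ v 0, ∃ b ∈ v 1, ColourAtom.Triangle a b c}
  RelMap := fun r => r.elim

/-- Infinitely many vertices do not admit an edge colouring with finitely many colours and no
monochromatic triangle. -/
theorem not_forall_exists_colour_of_infinite {D : Type*} {K : Type*} {R : K → D → D → Prop}
    (hmono : ∀ c x y z, R c x y → R c y z → ¬ R c x z) (C : Finset K) :
    ∀ S : Set D, S.Infinite → ¬ ∀ x ∈ S, ∀ y ∈ S, x ≠ y → ∃ c ∈ C, R c x y := by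
  classical
  induction C using Finset.strongInduction with
  | H C ih =>
    intro S hS hC
    obtain ⟨x, hx⟩ := hS.nonempty
    have hS' : (S \ {x}).Infinite := hS.sdiff (Set.finite_singleton x)
    have hcover : S \ {x} ⊆ ⋃ c ∈ C, {y ∈ S \ {x} | R c x y} := by
      intro y hy
      obtain ⟨c, hc, hr⟩ := hC x hx y hy.1 (Ne.symm hy.2)
      exact Set.mem_biUnion hc ⟨hy, hr⟩
    -- Infinitely many vertices are joined to `x` in a common colour `c`, and so not to each other.
    obtain ⟨c, hc, hinf⟩ : ∃ c ∈ C, {y ∈ S \ {x} | R c x y}.Infinite := by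
      by_contra! h
      refine hS' (Set.Finite.subset (C.finite_toSet.biUnion fun c hc => ?_) hcover)
      exact h c hc
    refine ih (C.erase c) (Finset.erase_ssubset hc) _ hinf ?_
    rintro y ⟨hy, hxy⟩ z ⟨hz, hxz⟩ hyz
    obtain ⟨d, hd, hr⟩ := hC y hy.1 z hz.1 hyz
    refine ⟨d, Finset.mem_erase.2 ⟨?_, hd⟩, hr⟩
    rintro rfl
    exact hmono d x y z hxy hr hxz

/-- The identity elements of infinitely many types are disjoint and nonempty in a feeble
representation, so the base is infinite, while its edges are coloured by finitely many colours
without monochromatic triangles. -/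
theorem not_isFeeblyRepresentableNA (I K : Type u) [Infinite I] [Finite K] :
    ¬ IsFeeblyRepresentableNA (Set (ColourAtom I K)) := by
  rintro ⟨-, D, φ, h⟩
  have hadd : ∀ S T : Set (ColourAtom I K), φ (S ∪ T) = φ S ∪ φ T := h.map_add
  have hempty : φ (∅ : Set (ColourAtom I K)) = ∅ := h.map_zero
  have hmono : ∀ S T : Set (ColourAtom I K), S ⊆ T → φ S ⊆ φ T := by
    intro S T hST
    rw [← Set.union_eq_self_of_subset_left hST, hadd]
    exact Set.subset_union_left
  have hdisj : ∀ S T : Set (ColourAtom I K), Disjoint S T → ∀ p ∈ φ S, p ∉ φ T := by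
    intro S T hST p hp hp'
    have h1 := h.map_neg T
    have h2 := hmono S Tᶜ hST.subset_compl_right hp
    exact ((show p ∈ Set.univ \ φ T from h1 ▸ h2).2) hp'
  have hid : φ {a : ColourAtom I K | a.lab = none} = SetRel.id := h.map_ident
  have hpoint : ∀ i : I, ∃ x : D, (x, x) ∈ φ {ColourAtom.ident i} := by
    intro i
    have hne : φ {ColourAtom.ident (K := K) i} ≠ ∅ := fun h' =>
      Set.singleton_ne_empty _ (h.injective (h'.trans hempty.symm))
    obtain ⟨⟨x, y⟩, hxy⟩ := Set.nonempty_iff_ne_empty.2 hne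
    have : (x, y) ∈ (SetRel.id : SetRel D D) := by
      rw [← hid]
      refine hmono _ _ ?_ hxy
      rintro _ rfl
      rfl
    obtain rfl : x = y := this
    exact ⟨x, hxy⟩
  choose x hx using hpoint
  have hinj : x.Injective := by
    intro i j hij
    by_contra hne
    refine hdisj {ColourAtom.ident i} {ColourAtom.ident j} ?_ _ (hx i) (hij ▸ hx j)
    rw [Set.disjoint_singleton]
    exact fun h' => hne (congrArg ColourAtom.src h')
  have : Fintype K := Fintype.ofFinite K
  have hunion : ∀ (C : Finset K) (p : D × D),
      p ∈ φ {a : ColourAtom I K | ∃ c ∈ C, a.lab = some c} →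
      ∃ c ∈ C, p ∈ φ {a : ColourAtom I K | a.lab = some c} := by
    classical
    intro C p
    induction C using Finset.induction with
    | empty => simp [hempty]
    | insert c C hc ih =>
      intro hp
      have : {a : ColourAtom I K | ∃ d ∈ insert c C, a.lab = some d} =
          {a | a.lab = some c} ∪ {a | ∃ d ∈ C, a.lab = some d} := by
        ext a; simp
      rw [this, hadd] at hp
      rcases hp with hp | hp
      · exact ⟨c, Finset.mem_insert_self _ _, hp⟩
      · obtain ⟨d, hd, hp⟩ := ih hp
        exact ⟨d, Finset.mem_insert_of_mem hd, hp⟩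
  refine not_forall_exists_colour_of_infinite
    (R := fun c y z => (y, z) ∈ φ {a : ColourAtom I K | a.lab = some c}) ?_ Finset.univ
    Set.univ ?_ ?_
  · intro c p q r hpq hqr
    refine hdisj _ _ ?_ _ (h.comp_subset _ _ ⟨q, hpq, hqr⟩)
    rw [Set.disjoint_left]
    rintro t ⟨a, ha, b, hb, hT⟩ ht
    exact hT.not_mono c ⟨ha, hb, ht⟩
  · have := Infinite.of_injective x hinj
    exact Set.infinite_univ
  · intro y _ z _ hyz
    apply hunion
    have h1 : (y, z) ∈ φ (Set.univ : Set (ColourAtom I K)) := by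
      have := h.map_one
      exact this ▸ Set.mem_univ (y, z)
    have h2 : (Set.univ : Set (ColourAtom I K)) =
        {a | a.lab = none} ∪ {a | ∃ c ∈ Finset.univ, a.lab = some c} := by
      ext a
      cases h : a.lab <;> simp [h]
    rw [h2, hadd, hid] at h1
    exact h1.resolve_left hyz

/-! ### Saturated colourings -/

/-- A complete graph on `D`, with vertices typed by `I` and edges coloured by `K`, that omits
monochromatic triangles and is saturated: every one-point extension of a vertex or of an edge
that is not a monochromatic triangle is realised. The values `col x x` are irrelevant. -/
structure IsSaturatedColouring {I K D : Type*} (typ : D → I) (col : D → D → K) : Prop where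
  symm : ∀ x y, col x y = col y x
  not_mono : ∀ x y z, x ≠ y → y ≠ z → x ≠ z → ¬ (col x y = col x z ∧ col x z = col y z)
  exists_point : ∀ i, ∃ x, typ x = i
  exists_edge : ∀ x c i, ∃ z, z ≠ x ∧ typ z = i ∧ col x z = c
  exists_apex : ∀ x y a b i, x ≠ y → ¬ (a = b ∧ b = col x y) →
    ∃ z, z ≠ x ∧ z ≠ y ∧ typ z = i ∧ col x z = a ∧ col z y = b

/-- The vertices of the free saturated colouring: a vertex of each type, and for each pair of
vertices `x`, `y`, colours `a`, `b` and type `i`, a vertex of type `i` meant to be joined to `x`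
by an edge of colour `a` and to `y` by one of colour `b`. -/
inductive FreePoint (I K : Type u) : Type u
  | base : I → FreePoint I K
  | apex : FreePoint I K → FreePoint I K → K → K → I → FreePoint I K

namespace FreePoint

open Classical in
/-- The colour that the construction of `z` prescribes for its edge to `w`, if any. -/
noncomputable def prescribed {I K : Type u} : FreePoint I K → FreePoint I K → Option K
  | base _, _ => none
  | apex x y a b _, w => if w = x then some a else if w = y then some b else none

/-- The type of a vertex. -/
def typ {I K : Type u} : FreePoint I K → I
  | base i => i
  | apex _ _ _ _ i => i

/-- The colours that occur in the outermost constructor of a vertex. -/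
def params {I K : Type u} : FreePoint I K → Set K
  | base _ => ∅
  | apex _ _ a b _ => {a, b}

variable {I K : Type u} (g : Sym2 (FreePoint I K) → K)

open Classical in
/-- The colour of the edge `x y`, where the prescriptions of `x` and of `y` are obeyed only if
`vx` and `vy` hold, respectively, and `g` supplies the colours that are not prescribed. Validity is
a parameter here because it is itself defined from colours of edges between simpler vertices. -/
noncomputable def colAux (x y : FreePoint I K) (vx vy : Prop) : K :=
  ((if vx then prescribed x y else none).or (if vy then prescribed y x else none)).getD (g s(x, y))

/-- Obeying the prescriptions of the vertex does not create a monochromatic triangle. If `x = y`,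
only the colour `a` is prescribed, and there is nothing to check. -/
def Valid : FreePoint I K → Prop
  | base _ => True
  | apex x y a b _ => x = y ∨ ¬ (a = b ∧ b = colAux g x y (Valid x) (Valid y))

/-- The colouring of the edges between the vertices. -/
noncomputable def col (x y : FreePoint I K) : K :=
  colAux g x y (Valid g x) (Valid g y)

/-- The edge from `z` to `w` has the colour `c` because `z` prescribes it. -/
def Forced (z w : FreePoint I K) (c : K) : Prop := Valid g z ∧ prescribed z w = some c

variable {g}

theorem sizeOf_lt_of_prescribed {z w : FreePoint I K} {c : K} (h : prescribed z w = some c) :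
    sizeOf w < sizeOf z := by
  cases z with
  | base i => simp [prescribed] at h
  | apex x y a b i =>
    simp only [prescribed] at h
    split_ifs at h with h1 h2 <;> subst_vars <;> simp <;> omega

theorem mem_params_of_prescribed {z w : FreePoint I K} {c : K} (h : prescribed z w = some c) :
    c ∈ params z := by
  cases z with
  | base i => simp [prescribed] at h
  | apex x y a b i =>
    simp only [prescribed] at h
    split_ifs at h with h1 h2 <;> simp_all [params]

theorem prescribed_eq_none {z w : FreePoint I K} {c : K} (h : prescribed z w = some c) :
    prescribed w z = none := by
  cases hw : prescribed w z with
  | none => rfl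
  | some d => exact absurd (sizeOf_lt_of_prescribed h) (sizeOf_lt_of_prescribed hw).asymm

theorem Forced.col_eq {z w : FreePoint I K} {c : K} (h : Forced g z w c) : col g z w = c := by
  simp [col, colAux, h.1, h.2]

theorem Forced.col_eq' {z w : FreePoint I K} {c : K} (h : Forced g z w c) : col g w z = c := by
  simp [col, colAux, h.1, h.2, prescribed_eq_none h.2]

theorem col_cases (x y : FreePoint I K) :
    (∃ c, Forced g x y c) ∨ (∃ c, Forced g y x c) ∨
      (col g x y = g s(x, y) ∧ col g y x = g s(x, y)) := by
  by_cases h1 : ∃ c, Forced g x y c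
  · exact .inl h1
  by_cases h2 : ∃ c, Forced g y x c
  · exact .inr (.inl h2)
  refine .inr (.inr ?_)
  have h1' : ¬ Valid g x ∨ prescribed x y = none := by
    by_contra! h
    obtain ⟨c, hc⟩ := Option.ne_none_iff_exists'.1 h.2
    exact h1 ⟨c, h.1, hc⟩
  have h2' : ¬ Valid g y ∨ prescribed y x = none := by
    by_contra! h
    obtain ⟨c, hc⟩ := Option.ne_none_iff_exists'.1 h.2
    exact h2 ⟨c, h.1, hc⟩
  rcases h1' with h1' | h1' <;> rcases h2' with h2' | h2' <;>
    simp [col, colAux, h1', h2', Sym2.eq_swap]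

theorem col_comm (x y : FreePoint I K) : col g x y = col g y x := by
  rcases col_cases (g := g) x y with ⟨c, h⟩ | ⟨c, h⟩ | ⟨h1, h2⟩
  · rw [h.col_eq, h.col_eq']
  · rw [h.col_eq, h.col_eq']
  · rw [h1, h2]

/-- Two edges forced by the same vertex do not close a monochromatic triangle. -/
theorem Forced.not_mono {x y z : FreePoint I K} {c : K} (hx : Forced g z x c)
    (hy : Forced g z y c) (hxy : x ≠ y) : col g x y ≠ c := by
  obtain ⟨hv, hx⟩ := hx
  obtain ⟨-, hy⟩ := hy
  cases z with
  | base i => simp [prescribed] at hx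
  | apex p q a b i =>
    intro hc
    have hc' := hc
    rw [col_comm] at hc'
    simp only [Valid, ← col.eq_def] at hv
    simp only [prescribed] at hx hy
    split_ifs at hx hy <;> simp_all

/-- The unprescribed colours are distinct and avoid those prescribed by the endpoints, so that
every monochromatic triangle would consist of three prescribed edges, two of them prescribed by
its most complex vertex. -/
theorem col_not_mono (hg : g.Injective) (hp : ∀ x y, g s(x, y) ∉ params x ∪ params y)
    {x y z : FreePoint I K} (hxy : x ≠ y) (hyz : y ≠ z) (hxz : x ≠ z) {c : K}
    (h1 : col g x y = c) (h2 : col g x z = c) (h3 : col g y z = c) : False := by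
  have key : ∀ x y : FreePoint I K, col g x y = c →
      Forced g x y c ∨ Forced g y x c ∨ g s(x, y) = c := by
    intro x y h
    rcases col_cases (g := g) x y with ⟨d, hd⟩ | ⟨d, hd⟩ | ⟨hd, -⟩
    · exact .inl (by rwa [hd.col_eq.symm.trans h] at hd)
    · exact .inr (.inl (by rwa [hd.col_eq'.symm.trans h] at hd))
    · exact .inr (.inr (hd.symm.trans h))
  -- If `x y` is unprescribed, the other two edges can only be prescribed by `z`.
  have fresh : ∀ x y z : FreePoint I K, x ≠ y → y ≠ z → x ≠ z → g s(x, y) = c →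
      col g x y = c → col g x z = c → col g y z = c → False := by
    intro x y z hxy hyz hxz h h1 h2 h3
    have hpx : c ∉ params x := fun h' => hp x y (h ▸ .inl h')
    have hpy : c ∉ params y := fun h' => hp x y (h ▸ .inr h')
    have hx : Forced g z x c := by
      rcases key x z h2 with h' | h' | h'
      · exact absurd (mem_params_of_prescribed h'.2) hpx
      · exact h'
      · have := hg (h.trans h'.symm)
        simp at this; tauto
    have hy : Forced g z y c := by
      rcases key y z h3 with h' | h' | h'
      · exact absurd (mem_params_of_prescribed h'.2) hpy
      · exact h'
      · have := hg (h.trans h'.symm)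
        simp at this; tauto
    exact hx.not_mono hy hxy h1
  -- Either some edge is unprescribed, or two edges are prescribed by a common vertex; cyclic
  -- prescription is impossible because a vertex prescribes only towards simpler ones.
  have h1' := (col_comm y x).trans h1
  have h2' := (col_comm z x).trans h2
  have h3' := (col_comm z y).trans h3
  have lt : ∀ {z w : FreePoint I K}, Forced g z w c → sizeOf w < sizeOf z :=
    fun h => sizeOf_lt_of_prescribed h.2
  rcases key x y h1 with k1 | k1 | k1
  · rcases key x z h2 with k2 | k2 | k2
    · exact k1.not_mono k2 hyz h3
    · rcases key y z h3 with k3 | k3 | k3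
      · have := lt k1; have := lt k2; have := lt k3; omega
      · exact k2.not_mono k3 hxy h1
      · exact fresh y z x hyz hxz.symm hxy.symm k3 h3 h1' h2'
    · exact fresh x z y hxz hyz.symm hxy k2 h2 h1 h3'
  · rcases key y z h3 with k3 | k3 | k3
    · exact k1.not_mono k3 hxz h2
    · rcases key x z h2 with k2 | k2 | k2
      · have := lt k1; have := lt k2; have := lt k3; omega
      · exact k2.not_mono k3 hxy h1
      · exact fresh x z y hxz hyz.symm hxy k2 h2 h1 h3'
    · exact fresh y z x hyz hxz.symm hxy.symm k3 h3 h1' h2'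
  · exact fresh x y z hxy hyz hxz k1 h1 h2 h3

theorem isSaturatedColouring (hg : g.Injective)
    (hp : ∀ x y, g s(x, y) ∉ params x ∪ params y) :
    IsSaturatedColouring (typ : FreePoint I K → I) (col g) where
  symm := col_comm
  not_mono x y z hxy hyz hxz h := col_not_mono hg hp hxy hyz hxz rfl h.1.symm (h.1.trans h.2).symm
  exists_point i := ⟨base i, rfl⟩
  exists_edge x c i := by
    have h : Forced g (apex x x c c i) x c := ⟨.inl rfl, by simp [prescribed]⟩
    refine ⟨apex x x c c i, fun h' => ?_, rfl, h.col_eq'⟩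
    have := sizeOf_lt_of_prescribed h.2
    simp [h'] at this
  exists_apex x y a b i hxy hab := by
    have hx : Forced g (apex x y a b i) x a := ⟨.inr hab, by simp [prescribed]⟩
    have hy : Forced g (apex x y a b i) y b := ⟨.inr hab, by simp [prescribed, hxy.symm]⟩
    refine ⟨apex x y a b i, fun h' => ?_, fun h' => ?_, rfl, hx.col_eq', hy.col_eq⟩
    · have := sizeOf_lt_of_prescribed hx.2
      simp [h'] at this
    · have := sizeOf_lt_of_prescribed hy.2
      simp [h'] at this

theorem params_finite (x : FreePoint I K) : (params x).Finite := by
  cases x <;> simp [params]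

/-- A point is coded by a single colour, by recursion on its construction. -/
theorem exists_injective_code [Infinite K] (hIK : Cardinal.mk I ≤ Cardinal.mk K) :
    ∃ f : FreePoint I K → K, f.Injective := by
  have hK := Cardinal.aleph0_le_mk K
  have : Cardinal.mk (I ⊕ (K × K × K × K × I)) ≤ Cardinal.mk K := by
    have hmul : ∀ {c : Cardinal.{u}}, c ≤ Cardinal.mk K → Cardinal.mk K * c ≤ Cardinal.mk K :=
      fun h => (mul_le_mul_right h _).trans (Cardinal.mul_eq_self hK).le
    simp only [Cardinal.mk_sum, Cardinal.mk_prod, Cardinal.lift_id]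
    exact Cardinal.add_le_of_le hK hIK (hmul (hmul (hmul (hmul hIK))))
  obtain ⟨e⟩ := this
  let f : FreePoint I K → K := fun x => FreePoint.rec (fun i => e (.inl i))
    (fun _ _ a b i cx cy => e (.inr (cx, cy, a, b, i))) x
  refine ⟨f, fun x => ?_⟩
  induction x with
  | base i =>
    intro y h
    cases y with
    | base j => simpa [f] using h
    | apex => simp [f] at h
  | apex x y a b i hx hy =>
    intro z h
    cases z with
    | base j => simp [f] at h
    | apex x' y' a' b' i' =>
      have h' := e.injective h
      simp only [Sum.inr.injEq, Prod.mk.injEq] at h'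
      obtain ⟨h1, h2, rfl, rfl, rfl⟩ := h'
      rw [hx h1, hy h2]

/-- Colours for the unprescribed edges: distinct, and not mentioned by the endpoints. -/
theorem exists_fresh_colours [Infinite K] (hIK : Cardinal.mk I ≤ Cardinal.mk K) :
    ∃ g : Sym2 (FreePoint I K) → K, g.Injective ∧
      ∀ x y, g s(x, y) ∉ params x ∪ params y := by
  obtain ⟨f, hf⟩ := exists_injective_code (K := K) hIK
  have hK := Cardinal.aleph0_le_mk K
  have : Cardinal.mk ((K × K) × ULift.{u} ℕ) ≤ Cardinal.mk K := by
    simp only [Cardinal.mk_prod, Cardinal.lift_id, Cardinal.mk_uLift, Cardinal.mk_nat,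
      Cardinal.lift_aleph0, Cardinal.mul_eq_self hK]
    exact (mul_le_mul_right hK _).trans (Cardinal.mul_eq_self hK).le
  obtain ⟨e⟩ := this
  -- Each unordered pair owns infinitely many colours, one of which avoids its parameters.
  let F : Sym2 (FreePoint I K) → ℕ → K := fun p n => e ((f p.out.1, f p.out.2), ⟨n⟩)
  have hF : ∀ p q m n, F p m = F q n → p = q ∧ m = n := by
    intro p q m n h
    have h' := e.injective h
    simp only [Prod.mk.injEq, ULift.up.injEq] at h'
    refine ⟨?_, h'.2⟩
    rw [← Quot.out_eq p, ← Quot.out_eq q, Prod.ext (hf h'.1.1) (hf h'.1.2)]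
  have hex : ∀ p : Sym2 (FreePoint I K), ∃ n, ∀ x ∈ p, F p n ∉ params x := by
    intro p
    induction p with | _ x y =>
    have hinf : (Set.range (F s(x, y))).Infinite :=
      Set.infinite_range_of_injective fun m n h => (hF _ _ _ _ h).2
    obtain ⟨_, ⟨n, rfl⟩, hn⟩ :=
      hinf.exists_notMem_finite ((params_finite x).union (params_finite y))
    refine ⟨n, fun w hw => ?_⟩
    rcases Sym2.mem_iff.1 hw with rfl | rfl
    · exact fun h => hn (.inl h)
    · exact fun h => hn (.inr h)
  choose n hn using hex
  refine ⟨fun p => F p (n p), fun p q h => (hF _ _ _ _ h).1, fun x y h => ?_⟩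
  exact h.elim (hn s(x, y) x (Sym2.mem_mk_left x y)) (hn s(x, y) y (Sym2.mem_mk_right x y))

end FreePoint

theorem exists_isSaturatedColouring {I K : Type u} [Infinite K]
    (hIK : Cardinal.mk I ≤ Cardinal.mk K) :
    ∃ (D : Type u) (typ : D → I) (col : D → D → K), IsSaturatedColouring typ col := by
  obtain ⟨g, hg, hp⟩ := FreePoint.exists_fresh_colours (K := K) hIK
  exact ⟨_, _, _, FreePoint.isSaturatedColouring hg hp⟩

/-! ### Representing the ultraproduct -/

section Ultraproduct

open Filter FirstOrder.Language FirstOrder.Language.Structure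

variable {U : Ultrafilter ℕ}

/-- A chosen representative of an element of an ultraproduct. -/
noncomputable def rep {E : ℕ → Type*} (t : (U : Filter ℕ).Product E) : ∀ k, E k :=
  Quotient.out (s := productSetoid _ _) t

/-- The class of a sequence in an ultraproduct. -/
def germ (U : Ultrafilter ℕ) {E : ℕ → Type*} (f : ∀ k, E k) : (U : Filter ℕ).Product E :=
  Quotient.mk (productSetoid _ _) f

theorem germ_eq_germ {E : ℕ → Type*} {f g : ∀ k, E k} :
    germ U f = germ U g ↔ ∀ᶠ k in U, f k = g k :=
  Quotient.eq (r := productSetoid _ _)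

theorem germ_rep {E : ℕ → Type*} (t : (U : Filter ℕ).Product E) : germ U (rep t) = t :=
  Quotient.out_eq (s := productSetoid _ _) t

theorem eventually_rep_eq {E : ℕ → Type*} {t : (U : Filter ℕ).Product E} {f : ∀ k, E k}
    (h : t = germ U f) : ∀ᶠ k in U, rep t k = f k :=
  germ_eq_germ.1 ((germ_rep t).trans h)

variable {I K : ℕ → Type u} {D : Type u} {typ : D → (U : Filter ℕ).Product I}
  {col : D → D → (U : Filter ℕ).Product K}

open Classical in
/-- The `k`-th coordinate of the atom that labels the pair `(x, y)`, an identity atom on the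
diagonal. It depends on the chosen representatives, but only for a negligible set of `k`. -/
noncomputable def atomAt (typ : D → (U : Filter ℕ).Product I)
    (col : D → D → (U : Filter ℕ).Product K) (x y : D) (k : ℕ) : ColourAtom (I k) (K k) where
  src := rep (typ x) k
  lab := if x = y then none else some (rep (col x y) k)
  tgt := rep (typ y) k
  eq_of_lab h := by
    by_cases hxy : x = y
    · rw [hxy]
    · simp [hxy] at h

/-- The pairs whose label lies in the element of the ultraproduct. -/
def labelRep (typ : D → (U : Filter ℕ).Product I) (col : D → D → (U : Filter ℕ).Product K)
    (S : (U : Filter ℕ).Product fun k => Set (ColourAtom (I k) (K k))) : SetRel D D :=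
  {p | ∀ᶠ k in U, atomAt typ col p.1 p.2 k ∈ rep S k}

theorem mem_labelRep_germ {S : ∀ k, Set (ColourAtom (I k) (K k))} {p : D × D} :
    p ∈ labelRep typ col (germ U S) ↔
      ∀ᶠ k in U, atomAt typ col p.1 p.2 k ∈ S k := by
  refine eventually_congr ?_
  filter_upwards [eventually_rep_eq (U := U) (f := S) rfl] with k hk
  rw [hk]

theorem atomAt_conv (h : IsSaturatedColouring typ col) (x y : D) (k : ℕ) :
    (atomAt typ col x y k).conv = atomAt typ col y x k := by
  ext1
  · rfl
  · simp only [atomAt, ColourAtom.conv, h.symm y x]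
    classical exact if_congr eq_comm rfl rfl
  · rfl

/-- The labels of a triangle of points are consistent: a monochromatic triangle of labels at almost
all coordinates would be one in the colouring. -/
theorem eventually_triangle (h : IsSaturatedColouring typ col) (x y z : D) :
    ∀ᶠ k in U, ColourAtom.Triangle (atomAt typ col x y k) (atomAt typ col y z k)
      (atomAt typ col x z k) := by
  have hsymm := h.symm
  have key : ∀ᶠ k in U, ∀ c, ¬ ((atomAt typ col x y k).lab = some c ∧
      (atomAt typ col y z k).lab = some c ∧ (atomAt typ col x z k).lab = some c) := by
    by_cases hd : x ≠ y ∧ y ≠ z ∧ x ≠ z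
    · obtain ⟨hxy, hyz, hxz⟩ := hd
      by_contra hn
      rw [← Ultrafilter.eventually_not] at hn
      refine h.not_mono x y z hxy hyz hxz ⟨?_, ?_⟩ <;>
      · refine (germ_rep _).symm.trans ((germ_eq_germ.2 ?_).trans (germ_rep _))
        filter_upwards [hn] with k hk
        push Not at hk
        obtain ⟨c, h1, h2, h3⟩ := hk
        simp only [atomAt, hxy, hyz, hxz, if_false, Option.some.injEq] at h1 h2 h3
        simp only [h1, h2, h3]
    · refine Eventually.of_forall fun k c ⟨h1, h2, h3⟩ => hd ⟨?_, ?_, ?_⟩ <;> rintro rfl <;>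
        simp [atomAt] at h1 h2 h3
  filter_upwards [key] with k hk
  refine ⟨rfl, rfl, rfl, ?_, ?_, ?_, hk⟩
  · intro h'
    have : x = y := by by_contra hn; simp [atomAt, hn] at h'
    rw [this]
  · intro h'
    have : y = z := by by_contra hn; simp [atomAt, hn] at h'
    rw [this]
  · intro h'
    have : x = z := by by_contra hn; simp [atomAt, hn] at h'
    subst this
    simp only [atomAt, hsymm x y]
    classical exact if_congr eq_comm rfl rfl

/-- In the ultraproduct, a label is either the identity or a colour. -/
theorem eventually_lab_eq [∀ k, Nonempty (K k)] (a : ∀ k, ColourAtom (I k) (K k)) :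
    (∀ᶠ k in U, (a k).lab = none) ∨ ∃ c : ∀ k, K k, ∀ᶠ k in U, (a k).lab = some (c k) := by
  by_cases h : ∀ᶠ k in U, (a k).lab = none
  · exact .inl h
  · rw [← Ultrafilter.eventually_not] at h
    have : ∀ k, ∃ c : K k, (a k).lab ≠ none → (a k).lab = some c := by
      intro k
      cases hk : (a k).lab with
      | none => exact ⟨Classical.arbitrary _, fun h => absurd rfl h⟩
      | some c => exact ⟨c, fun _ => rfl⟩
    choose c hc using this
    exact .inr ⟨c, h.mono hc⟩

/-- The edges of a vertex of the given type realise all labels. -/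
theorem exists_eventually_atomAt_eq_left [∀ k, Nonempty (K k)] (h : IsSaturatedColouring typ col)
    (a : ∀ k, ColourAtom (I k) (K k)) {x : D} (hx : ∀ᶠ k in U, rep (typ x) k = (a k).src) :
    ∃ y, ∀ᶠ k in U, atomAt typ col x y k = a k := by
  rcases eventually_lab_eq (U := U) a with ha | ⟨c, hc⟩
  · refine ⟨x, ?_⟩
    filter_upwards [hx, ha] with k h1 h2
    have := (a k).eq_of_lab h2
    ext1 <;> simp [atomAt, *]
  · obtain ⟨y, hne, ht, hcol⟩ := h.exists_edge x (germ U c) (germ U fun k => (a k).tgt)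
    refine ⟨y, ?_⟩
    filter_upwards [hx, hc, eventually_rep_eq ht, eventually_rep_eq hcol] with k h1 h2 h3 h4
    ext1 <;> simp [atomAt, hne.symm, h1, h2, h3, h4]

theorem exists_eventually_atomAt_eq [∀ k, Nonempty (K k)] (h : IsSaturatedColouring typ col)
    (a : ∀ k, ColourAtom (I k) (K k)) :
    ∃ x y, ∀ᶠ k in U, atomAt typ col x y k = a k := by
  obtain ⟨x, hx⟩ := h.exists_point (germ U fun k => (a k).src)
  exact ⟨x, exists_eventually_atomAt_eq_left h a (eventually_rep_eq hx)⟩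

/-- Every way in which the algebra factors the label of a pair is witnessed by a point. -/
theorem exists_eventually_atomAt_eq_and [∀ k, Nonempty (K k)] (h : IsSaturatedColouring typ col)
    (a b : ∀ k, ColourAtom (I k) (K k)) {x y : D}
    (hT : ∀ᶠ k in U, ColourAtom.Triangle (a k) (b k) (atomAt typ col x y k)) :
    ∃ z, (∀ᶠ k in U, atomAt typ col x z k = a k) ∧ ∀ᶠ k in U, atomAt typ col z y k = b k := by
  have hx : ∀ᶠ k in U, rep (typ x) k = (a k).src := hT.mono fun k hk => hk.src_eq.symm
  have hy : ∀ᶠ k in U, (b k).tgt = rep (typ y) k := hT.mono fun k hk => hk.tgt_eq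
  rcases eventually_lab_eq (U := U) a with ha | ⟨c, hc⟩
  · refine ⟨x, ?_, ?_⟩
    · filter_upwards [hx, ha] with k h1 h2
      have := (a k).eq_of_lab h2
      ext1 <;> simp [atomAt, *]
    · filter_upwards [hT, ha] with k h1 h2
      ext1
      · exact h1.src_eq.symm.trans (((a k).eq_of_lab h2).trans h1.mid_eq)
      · exact (h1.left_ident h2).symm
      · exact h1.tgt_eq.symm
  rcases eventually_lab_eq (U := U) b with hb | ⟨d, hd⟩
  · refine ⟨y, ?_, ?_⟩
    · filter_upwards [hT, hb] with k h1 h2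
      ext1
      · exact h1.src_eq.symm
      · exact (h1.right_ident h2).symm
      · exact (h1.mid_eq.trans (((b k).eq_of_lab h2).trans h1.tgt_eq)).symm
    · filter_upwards [hy, hb] with k h1 h2
      have := (b k).eq_of_lab h2
      ext1 <;> simp [atomAt, *]
  by_cases hxy : x = y
  · subst hxy
    obtain ⟨z, hz⟩ := exists_eventually_atomAt_eq_left h a hx
    refine ⟨z, hz, ?_⟩
    filter_upwards [hz, hT] with k h1 h2
    rw [← atomAt_conv h, h1]
    ext1
    · exact h2.mid_eq
    · exact h2.ident_eq (by simp [atomAt])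
    · exact h2.src_eq.trans h2.tgt_eq.symm
  -- The labels `a`, `b` do not make a monochromatic triangle with `x y`, also as germs.
  · have hmono : ¬ (germ U c = germ U d ∧
        germ U d = col x y) := by
      rintro ⟨h1, h2⟩
      obtain ⟨k, h1, h2, h3, h4, h5⟩ := ((germ_eq_germ.1 h1).and ((eventually_rep_eq h2.symm).and
        (hc.and (hd.and hT)))).exists
      refine h5.not_mono (c k) ⟨h3, h4.trans (congrArg some h1.symm), ?_⟩
      simp [atomAt, hxy, h2, h1]
    obtain ⟨z, hzx, hzy, ht, h1, h2⟩ :=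
      h.exists_apex x y (germ U c) (germ U d) (germ U fun k => (a k).tgt) hxy hmono
    have ht' := eventually_rep_eq ht
    refine ⟨z, ?_, ?_⟩
    · filter_upwards [hx, hc, ht', eventually_rep_eq h1] with k h1 h2 h3 h4
      ext1 <;> simp [atomAt, hzx.symm, h1, h2, h3, h4]
    · filter_upwards [hT, hd, ht', eventually_rep_eq h2] with k h1 h2 h3 h4
      ext1
      · exact h3.trans h1.mid_eq
      · simp [atomAt, hzy, h2, h4]
      · exact h1.tgt_eq.symm

section Operations

variable (S T : ∀ k, Set (ColourAtom (I k) (K k)))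

theorem ultraproduct_zero : (zero : (U : Filter ℕ).Product fun k => Set (ColourAtom (I k) (K k))) =
    germ U fun _ => ∅ :=
  (congrArg (funMap (L := relAlgLang) RelAlgFunc.zero) (Subsingleton.elim _ _)).trans
    (Ultraproduct.funMap_cast (L := relAlgLang) RelAlgFunc.zero ![])

theorem ultraproduct_one : (one : (U : Filter ℕ).Product fun k => Set (ColourAtom (I k) (K k))) =
    germ U fun _ => Set.univ :=
  (congrArg (funMap (L := relAlgLang) RelAlgFunc.one) (Subsingleton.elim _ _)).trans
    (Ultraproduct.funMap_cast (L := relAlgLang) RelAlgFunc.one ![])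

theorem ultraproduct_ident :
    (ident : (U : Filter ℕ).Product fun k => Set (ColourAtom (I k) (K k))) =
    germ U fun _ => {a | a.lab = none} :=
  (congrArg (funMap (L := relAlgLang) RelAlgFunc.ident) (Subsingleton.elim _ _)).trans
    (Ultraproduct.funMap_cast (L := relAlgLang) RelAlgFunc.ident ![])

theorem ultraproduct_neg : neg (germ U S) = germ U fun k => (S k)ᶜ :=
  (congrArg (funMap (L := relAlgLang) RelAlgFunc.neg) (by funext i; fin_cases i; rfl)).trans
    (Ultraproduct.funMap_cast (L := relAlgLang) RelAlgFunc.neg ![S])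

theorem ultraproduct_conv : conv (germ U S) = germ U fun k => {a | a.conv ∈ S k} :=
  (congrArg (funMap (L := relAlgLang) RelAlgFunc.conv) (by funext i; fin_cases i; rfl)).trans
    (Ultraproduct.funMap_cast (L := relAlgLang) RelAlgFunc.conv ![S])

theorem ultraproduct_add : add (germ U S) (germ U T) = germ U fun k => S k ∪ T k :=
  (congrArg (funMap (L := relAlgLang) RelAlgFunc.add) (by funext i; fin_cases i <;> rfl)).trans
    (Ultraproduct.funMap_cast (L := relAlgLang) RelAlgFunc.add ![S, T])

theorem ultraproduct_comp : comp (germ U S) (germ U T) =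
    germ U fun k => {c | ∃ a ∈ S k, ∃ b ∈ T k, ColourAtom.Triangle a b c} :=
  (congrArg (funMap (L := relAlgLang) RelAlgFunc.comp) (by funext i; fin_cases i <;> rfl)).trans
    (Ultraproduct.funMap_cast (L := relAlgLang) RelAlgFunc.comp ![S, T])

end Operations

theorem IsSaturatedColouring.isRepresentationBase [∀ k, Nonempty (I k)] [∀ k, Nonempty (K k)]
    (h : IsSaturatedColouring typ col) : IsRepresentationBase (labelRep typ col) where
  injective S T hST := by
    obtain ⟨S, rfl⟩ : ∃ f, germ U f = S := ⟨_, germ_rep S⟩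
    obtain ⟨T, rfl⟩ : ∃ f, germ U f = T := ⟨_, germ_rep T⟩
    refine germ_eq_germ.2 ?_
    by_contra hn
    rw [← Ultrafilter.eventually_not] at hn
    have hex : ∀ k, ∃ a : ColourAtom (I k) (K k), S k ≠ T k → ¬ (a ∈ S k ↔ a ∈ T k) := by
      intro k
      by_cases hk : S k = T k
      · exact ⟨.ident (Classical.arbitrary _), absurd hk⟩
      · obtain ⟨a, ha⟩ := not_forall.1 (mt Set.ext hk)
        exact ⟨a, fun _ => ha⟩
    choose a ha using hex
    obtain ⟨x, y, hxy⟩ := exists_eventually_atomAt_eq h a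
    have hiff : (∀ᶠ k in U, a k ∈ S k) ↔ ∀ᶠ k in U, a k ∈ T k := by
      have h1 : ((x, y) ∈ labelRep typ col _) ↔ (x, y) ∈ labelRep typ col _ :=
        Set.ext_iff.1 hST (x, y)
      refine (eventually_congr ?_).trans ((mem_labelRep_germ.symm.trans (h1.trans
        mem_labelRep_germ)).trans (eventually_congr ?_)) <;>
      · filter_upwards [hxy] with k hk
        rw [hk]
    have hne : ∀ᶠ k in U, ¬ (a k ∈ S k ↔ a k ∈ T k) := hn.mono ha
    by_cases hS : ∀ᶠ k in U, a k ∈ S k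
    · obtain ⟨k, h1, h2, h3⟩ := (hS.and ((hiff.1 hS).and hne)).exists
      exact h3 (iff_of_true h1 h2)
    · have hT := mt hiff.2 hS
      rw [← Ultrafilter.eventually_not] at hS hT
      obtain ⟨k, h1, h2, h3⟩ := (hS.and (hT.and hne)).exists
      exact h3 (iff_of_false h1 h2)
  map_zero := by
    ext p
    rw [ultraproduct_zero]
    refine mem_labelRep_germ.trans ?_
    simp [U.neBot.ne]
  map_one := by
    ext p
    rw [ultraproduct_one]
    refine mem_labelRep_germ.trans ?_
    simp
  map_ident := by
    ext ⟨x, y⟩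
    rw [ultraproduct_ident]
    refine mem_labelRep_germ.trans ?_
    by_cases hxy : x = y <;> simp [atomAt, hxy, SetRel.id, U.neBot.ne]
  map_add S T := by
    obtain ⟨S, rfl⟩ : ∃ f, germ U f = S := ⟨_, germ_rep S⟩
    obtain ⟨T, rfl⟩ : ∃ f, germ U f = T := ⟨_, germ_rep T⟩
    ext p
    rw [ultraproduct_add]
    refine mem_labelRep_germ.trans (Ultrafilter.eventually_or.trans ?_)
    exact or_congr mem_labelRep_germ.symm mem_labelRep_germ.symm
  map_neg S := by
    obtain ⟨S, rfl⟩ : ∃ f, germ U f = S := ⟨_, germ_rep S⟩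
    ext p
    rw [ultraproduct_neg]
    refine mem_labelRep_germ.trans (Ultrafilter.eventually_not.trans ?_)
    exact (not_congr mem_labelRep_germ.symm).trans (by simp)
  map_conv S := by
    obtain ⟨S, rfl⟩ : ∃ f, germ U f = S := ⟨_, germ_rep S⟩
    ext ⟨x, y⟩
    rw [ultraproduct_conv]
    refine mem_labelRep_germ.trans (Iff.trans ?_ mem_labelRep_germ.symm)
    simp [atomAt_conv h]

theorem IsSaturatedColouring.map_comp [∀ k, Nonempty (K k)]
    (h : IsSaturatedColouring typ col)
    (S T : (U : Filter ℕ).Product fun k => Set (ColourAtom (I k) (K k))) :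
    labelRep typ col (comp S T) = (labelRep typ col S).comp (labelRep typ col T) := by
  obtain ⟨S, rfl⟩ : ∃ f, germ U f = S := ⟨_, germ_rep S⟩
  obtain ⟨T, rfl⟩ : ∃ f, germ U f = T := ⟨_, germ_rep T⟩
  ext ⟨x, y⟩
  rw [ultraproduct_comp]
  refine mem_labelRep_germ.trans ⟨fun hxy => ?_, ?_⟩
  · have hex : ∀ k, ∃ a b : ColourAtom (I k) (K k),
        (atomAt typ col x y k ∈ {c | ∃ a ∈ S k, ∃ b ∈ T k, ColourAtom.Triangle a b c}) →
        a ∈ S k ∧ b ∈ T k ∧ ColourAtom.Triangle a b (atomAt typ col x y k) := by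
      intro k
      by_cases hk : atomAt typ col x y k ∈ {c | ∃ a ∈ S k, ∃ b ∈ T k, ColourAtom.Triangle a b c}
      · obtain ⟨a, ha, b, hb, hT⟩ := hk
        exact ⟨a, b, fun _ => ⟨ha, hb, hT⟩⟩
      · exact ⟨atomAt typ col x y k, atomAt typ col x y k, fun h' => absurd h' hk⟩
    choose a b hab using hex
    have hab' := hxy.mono hab
    obtain ⟨z, hz1, hz2⟩ := exists_eventually_atomAt_eq_and h a b (hab'.mono fun k hk => hk.2.2)
    refine ⟨z, mem_labelRep_germ.2 ?_, mem_labelRep_germ.2 ?_⟩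
    · filter_upwards [hz1, hab'] with k h1 h2
      exact h1 ▸ h2.1
    · filter_upwards [hz2, hab'] with k h1 h2
      exact h1 ▸ h2.2.1
  · rintro ⟨z, h1, h2⟩
    filter_upwards [mem_labelRep_germ.1 h1, mem_labelRep_germ.1 h2, eventually_triangle h x z y]
      with k h1 h2 h3
    exact ⟨_, h1, _, h2, h3⟩

theorem IsSaturatedColouring.isStronglyRepresentableRA [∀ k, Nonempty (I k)] [∀ k, Nonempty (K k)]
    (h : IsSaturatedColouring typ col) :
    IsStronglyRepresentableRA ((U : Filter ℕ).Product fun k => Set (ColourAtom (I k) (K k))) :=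
  ⟨h.isRepresentationBase.isRelationAlgebra h.map_comp,
    D, _, h.isRepresentationBase.isStrongRepresentation h.map_comp⟩

end Ultraproduct

/-- The ultraproduct of the colour sets `2 ^ k` has the power of the continuum: two sequences of
bits that differ have different restrictions to all long enough initial segments. -/
theorem mk_product_nat_le (U : Ultrafilter ℕ) (hU : (U : Filter ℕ) ≤ Filter.atTop) :
    Cardinal.mk ((U : Filter ℕ).Product fun _ => ULift.{u} ℕ) ≤
      Cardinal.mk ((U : Filter ℕ).Product fun k => ULift.{u} (Fin k → Bool)) := by
  have h1 : Cardinal.mk ((U : Filter ℕ).Product fun _ => ULift.{u} ℕ) ≤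
      Cardinal.mk (ℕ → ULift.{u} ℕ) := Cardinal.mk_quotient_le
  have h2 : Cardinal.mk (ℕ → ULift.{u} ℕ) = Cardinal.mk (ULift.{u} (ℕ → Bool)) := by
    simp
  rw [h2] at h1
  refine h1.trans ⟨⟨fun f => germ U fun k => ⟨fun i => f.down i⟩, fun f g hfg => ?_⟩⟩
  ext n
  obtain ⟨k, hk, hn⟩ := ((germ_eq_germ.1 hfg).and (hU (Filter.eventually_gt_atTop n))).exists
  exact congrFun (congrArg ULift.down hk) ⟨n, hn⟩

end RelAlg

theorem mainTheorem3 (K : RelAlg.AlgebraClass.{u})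
    (hstrong : ∀ A : CategoryTheory.Bundled.{u} relAlgLang.Structure,
      RelAlg.IsStronglyRepresentableRA A → A ∈ K)
    (hfeeble : ∀ A : CategoryTheory.Bundled.{u} relAlgLang.Structure,
      A ∈ K → RelAlg.IsFeeblyRepresentableNA A) :
    ¬ RelAlg.FinitelyAxiomatisable K := by
  rintro ⟨T, hT, hK⟩
  let U : Ultrafilter ℕ := Ultrafilter.of Filter.atTop
  have hU : (U : Filter ℕ) ≤ Filter.atTop := Ultrafilter.of_le _
  let I : ℕ → Type u := fun _ => ULift.{u} ℕ
  let C : ℕ → Type u := fun k => ULift.{u} (Fin k → Bool)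
  have hIC := RelAlg.mk_product_nat_le.{u} U hU
  have hinf : Infinite ((U : Filter ℕ).Product C) := by
    have : Infinite ((U : Filter ℕ).Product I) := by
      refine Infinite.of_injective
        (fun n : ℕ => RelAlg.germ U (E := I) fun _ => ⟨n⟩) fun m n h => ?_
      obtain ⟨k, hk⟩ := (RelAlg.germ_eq_germ.1 h).exists
      exact congrArg ULift.down hk
    exact Cardinal.infinite_iff.2 ((Cardinal.infinite_iff.1 this).trans hIC)
  obtain ⟨D, typ, col, h⟩ := RelAlg.exists_isSaturatedColouring hIC
  let A : ℕ → Type u := fun k => Set (RelAlg.ColourAtom (I k) (C k))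
  have hmem := hstrong ⟨(U : Filter ℕ).Product A, inferInstance⟩ h.isStronglyRepresentableRA
  have hmodel : (U : Filter ℕ).Product A ⊨ T := (hK _).1 hmem
  -- Łoś's theorem, and the finiteness of `T`, give a model of `T` among the factors.
  have hev : ∀ᶠ k in U, ∀ σ ∈ T, A k ⊨ σ :=
    (Filter.eventually_all_finite hT).2 fun σ hσ =>
      (FirstOrder.Language.Ultraproduct.sentence_realize σ).1 (hmodel.realize_of_mem σ hσ)
  obtain ⟨k, hk⟩ := hev.exists
  have hk' := hfeeble ⟨A k, inferInstance⟩ ((hK ⟨A k, inferInstance⟩).2 ⟨fun σ hσ => hk σ hσ⟩)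
  exact RelAlg.not_isFeeblyRepresentableNA (I k) (C k) hk'
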